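/- **Notation.** Let $n\ge 1$ and $m\ge 0$ be integers and let $\mu$ be Lebesgue measure on $\mathbb{R}^n$. For a nonempty bounded open convex set $\Omega\subset\mathbb{R}^n$ let $d=d(\Omega)$ be the diameter of the smallest ball containing $\Omega$, $\rho_{\max}(\Omega)$ the radius of the largest ball contained in $\Omega$, and $\gamma(\Omega)=d/\rho_{\max}$. Let $W^m_\infty(\Omega)$ be the space of functions on $\Omega$ all of whose weak derivatives $D^\alpha u$, $|\alpha|\le m$, exist and lie in $L_\infty(\Omega)$, with $\|u\|_{W^m_\infty(\Omega)}=\max_{|\alpha|\le m}\|D^\alpha u\|_{L_\infty(\Omega)}$. Let $S_n=\{x\in\mathbb{R}^n : x_i\ge 0,\ \sum_i x_i\le 1\}$ be the standard simplex. A quadrature rule $Q$ on $S_n$ is given by finitely many nodes $x_k\in S_n$ and real weights $w_k$ (of any sign), $Q(f)=\sum_k w_k f(x_k)$; put $W=\sum_k|w_k|$. It is exact of degree $m$ if $\sum_k w_k\,p(x_k)=\int_{S_n}p$ for every polynomial $p$ of degree at most $m$. If $\Omega$ is the open simplex with affinely independent vertices $v_0,\dots,v_n\in\mathbb{R}^n$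 and $A$ is the matrix with columns $v_1-v_0,\dots,v_n-v_0$, the transferred rule is $$Q(f)=|\det A|\sum_k w_k\, f(v_0+Ax_k),\qquad f:\overline\Omega\to\mathbb{R}.$$ **Theorem.** There are constants $C_{m,n,\gamma}$, depending only on $m\ge0$, $n\ge1$ and $\gamma$, with the following two properties. (1) For every nonempty bounded open convex $\Omega\subset\mathbb{R}^n$ with $\gamma(\Omega)=\gamma$ and every $u\in W^m_\infty(\Omega)$ there is a polynomial $u^*$ of degree at most $m$ such that $\|u-u^*\|_{L_\infty(\Omega)}\le C_{m,n,\gamma}\,d^m\,\|u\|_{W^m_\infty(\Omega)}$ (the Bramble–Hilbert estimate). (2) Let $Q$ be a quadrature rule on $S_n$ that is exact of degree $m$, let $\Omega\subset\mathbb{R}^n$ be a nondegenerate open simplex with $\gamma(\Omega)=\gamma$, and let $u\in W^m_\infty(\Omega)$. If $m\ge 1$, then $u$ agrees almost everywhere in $\Omega$ with a function that is continuous on $\overline\Omega$. Whenever $u$ has such a continuous representative (also if $m=0$), and $Q(u)$ is computed from the values of that representative, $$\left|Q(u)-\int_\Omega u\right|\le\left(\frac{W}{\mu(S_n)}+1\right)\mu(\Omega)\,C_{m,n,\gamma}\,d^m\,\|u\|_{W^m_\infty(\Omega)}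 .$$ -/

import Mathlib

open MeasureTheory
open scoped ContDiff ENNReal

noncomputable section

namespace SimplexQuadrature

/-- `g` is the weak partial derivative `∂_{I 0} ⋯ ∂_{I (k-1)} u` of order `k` on the open set `Ω`:
both functions are locally integrable on `Ω`, and
`∫_Ω u ∂_{I 0} ⋯ ∂_{I (k-1)} φ = (-1)^k ∫_Ω g φ` for every test function `φ ∈ C_c^∞(Ω)`.
A multi-index `α` with `|α| = k` is written as a list `I` of `k` coordinate directions in which
direction `i` occurs `α i` times; the order of the list is immaterial, since `φ` is smooth. -/
def HasWeakDeriv {n k : ℕ} (Ω : Set (EuclideanSpace ℝ (Fin n)))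
    (u : EuclideanSpace ℝ (Fin n) → ℝ) (I : Fin k → Fin n)
    (g : EuclideanSpace ℝ (Fin n) → ℝ) : Prop :=
  LocallyIntegrableOn u Ω ∧ LocallyIntegrableOn g Ω ∧
    ∀ φ : EuclideanSpace ℝ (Fin n) → ℝ,
      ContDiff ℝ ∞ φ → HasCompactSupport φ → tsupport φ ⊆ Ω →
        ∫ x in Ω, u x * iteratedFDeriv ℝ k φ x (fun j => EuclideanSpace.single (I j) (1 : ℝ)) =
          (-1) ^ k * ∫ x in Ω, g x * φ x

open scoped Classical in
/-- A chosen weak partial derivative (it is unique up to null sets on an open set `Ω`);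
the zero function if there is none. -/
def weakDeriv {n k : ℕ} (Ω : Set (EuclideanSpace ℝ (Fin n)))
    (u : EuclideanSpace ℝ (Fin n) → ℝ) (I : Fin k → Fin n) : EuclideanSpace ℝ (Fin n) → ℝ :=
  if h : ∃ g, HasWeakDeriv Ω u I g then h.choose else 0

/-- Membership in the Sobolev space `W^m_∞(Ω)`: all weak partial derivatives of order `0, …, m`
exist on `Ω` and are essentially bounded. -/
def MemSobolev {n : ℕ} (m : ℕ) (Ω : Set (EuclideanSpace ℝ (Fin n)))
    (u : EuclideanSpace ℝ (Fin n) → ℝ) : Prop :=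
  ∀ k ≤ m, ∀ I : Fin k → Fin n,
    ∃ g, HasWeakDeriv Ω u I g ∧ MemLp g ∞ (volume.restrict Ω)

/-- The norm of `W^m_∞(Ω)`: the maximum of the `L_∞(Ω)` norms of the weak partial derivatives of
order `0, …, m`. -/
def sobolevNorm {n : ℕ} (m : ℕ) (Ω : Set (EuclideanSpace ℝ (Fin n)))
    (u : EuclideanSpace ℝ (Fin n) → ℝ) : ℝ :=
  (⨆ (k : Fin (m + 1)) (I : Fin (k : ℕ) → Fin n),
    eLpNorm (weakDeriv Ω u I) ∞ (volume.restrict Ω)).toReal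

/-- The diameter of the smallest ball containing `Ω`. -/
def enclosingDiam {n : ℕ} (Ω : Set (EuclideanSpace ℝ (Fin n))) : ℝ :=
  2 * sInf {r : ℝ | 0 ≤ r ∧ ∃ c, Ω ⊆ Metric.closedBall c r}

/-- The radius of the largest ball contained in `Ω`. -/
def inradius {n : ℕ} (Ω : Set (EuclideanSpace ℝ (Fin n))) : ℝ :=
  sSup {r : ℝ | 0 ≤ r ∧ ∃ c, Metric.ball c r ⊆ Ω}

/-- The chunkiness parameter `γ = d / ρ_max`. -/
def chunkiness {n : ℕ} (Ω : Set (EuclideanSpace ℝ (Fin n))) : ℝ :=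
  enclosingDiam Ω / inradius Ω

/-- `c` is a constant in the Bramble–Hilbert estimate with `p = ∞`, `k = 0`, for order `m`,
dimension `n` and chunkiness `γ`: on every (nonempty, bounded, open) convex domain `Ω` of `ℝⁿ` with
that chunkiness, each `u ∈ W^m_∞(Ω)` has a polynomial `p` of degree at most `m` with
`‖u - p‖_{L_∞(Ω)} ≤ c d^m ‖u‖_{W^m_∞(Ω)}`. -/
def IsBrambleHilbertConstant (m n : ℕ) (γ c : ℝ) : Prop :=
  ∀ Ω : Set (EuclideanSpace ℝ (Fin n)),
    Ω.Nonempty → Bornology.IsBounded Ω → IsOpen Ω → Convex ℝ Ω → chunkiness Ω = γ →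
      ∀ u : EuclideanSpace ℝ (Fin n) → ℝ, MemSobolev m Ω u →
        ∃ p : MvPolynomial (Fin n) ℝ, p.totalDegree ≤ m ∧
          ∀ᵐ x ∂(volume.restrict Ω),
            |u x - MvPolynomial.eval (fun i => x i) p|
              ≤ c * enclosingDiam Ω ^ m * sobolevNorm m Ω u

/-- The standard simplex `S_n = {x ∈ ℝⁿ | x_i ≥ 0, ∑ x_i ≤ 1}`. -/
def standardSimplex (n : ℕ) : Set (EuclideanSpace ℝ (Fin n)) :=
  {x | (∀ i, 0 ≤ x i) ∧ ∑ i, x i ≤ 1}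

/-- A quadrature rule `f ↦ ∑ w_k f(x_k)` on the standard simplex: finitely many nodes in `S_n`,
with real weights of any sign. -/
structure QuadratureRule (n : ℕ) where
  /-- the number of nodes -/
  size : ℕ
  /-- the weights -/
  weight : Fin size → ℝ
  /-- the nodes -/
  node : Fin size → EuclideanSpace ℝ (Fin n)
  node_mem : ∀ k, node k ∈ standardSimplex n

/-- The rule integrates every polynomial of degree at most `m` exactly over `S_n`. -/
def QuadratureRule.IsExact {n : ℕ} (Q : QuadratureRule n) (m : ℕ) : Prop :=
  ∀ p : MvPolynomial (Fin n) ℝ, p.totalDegree ≤ m →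
    ∑ k, Q.weight k * MvPolynomial.eval (fun i => Q.node k i) p =
      ∫ x in standardSimplex n, MvPolynomial.eval (fun i => x i) p

/-- The number `W = ∑ |w_k|`. -/
def QuadratureRule.absWeight {n : ℕ} (Q : QuadratureRule n) : ℝ :=
  ∑ k, |Q.weight k|

/-- The closed simplex with vertices `v_0, …, v_n`. -/
def closedSimplex {n : ℕ} (T : Affine.Simplex ℝ (EuclideanSpace ℝ (Fin n)) n) :
    Set (EuclideanSpace ℝ (Fin n)) :=
  convexHull ℝ (Set.range T.points)

/-- The open simplex with vertices `v_0, …, v_n`. -/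
def openSimplex {n : ℕ} (T : Affine.Simplex ℝ (EuclideanSpace ℝ (Fin n)) n) :
    Set (EuclideanSpace ℝ (Fin n)) :=
  interior (closedSimplex T)

/-- The matrix with columns `v_1 - v_0, …, v_n - v_0`. -/
def edgeMatrix {n : ℕ} (T : Affine.Simplex ℝ (EuclideanSpace ℝ (Fin n)) n) :
    Matrix (Fin n) (Fin n) ℝ :=
  Matrix.of fun i j => T.points j.succ i - T.points 0 i

/-- The affine map `x ↦ v_0 + ∑ x_j (v_j - v_0)` of the standard simplex onto the simplex with
vertices `v_0, …, v_n`. -/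
def refMap {n : ℕ} (T : Affine.Simplex ℝ (EuclideanSpace ℝ (Fin n)) n)
    (x : EuclideanSpace ℝ (Fin n)) : EuclideanSpace ℝ (Fin n) :=
  T.points 0 + Matrix.toEuclideanLin (edgeMatrix T) x

/-- The rule transferred to another simplex by the affine change of variables:
`Q(f) = |det A| ∑ w_k f(A x_k + v_0)`. -/
def QuadratureRule.apply {n : ℕ} (Q : QuadratureRule n)
    (T : Affine.Simplex ℝ (EuclideanSpace ℝ (Fin n)) n)
    (f : EuclideanSpace ℝ (Fin n) → ℝ) : ℝ :=
  |(edgeMatrix T).det| * ∑ k, Q.weight k * f (refMap T (Q.node k))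

end SimplexQuadrature

end

/-!
The constant `n ^ m` works for every chunkiness: on a convex domain the Bramble–Hilbert polynomial
can be taken to be a Taylor polynomial at a single point, and no averaging over an inscribed ball is
needed in the `L_∞` setting.

For a smooth function whose derivatives of order `m` are bounded by `M` along the segment from `a`
to `x`, one-variable Taylor expansion on this segment gives a remainder of at most
`n ^ m |x - a| ^ m M` (`abs_sub_eval_taylorPoly_le`). A function `u ∈ W^m_∞(Ω)` is reduced to this
case by mollification. Integration by parts against the mollifier shows that the derivatives of the
mollified functions are averages of the weak derivatives of `u`, so on compact subsets of `Ω` they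
are eventually bounded by the Sobolev norm
(`HasWeakDeriv.abs_iteratedFDeriv_convolution_le`, `MemSobolev.exists_smooth_approx`).

Two limits follow. The coefficients of the Taylor polynomials at a fixed point of `Ω` stay bounded,
so a subsequence converges to a polynomial satisfying the estimate almost everywhere
(`isBrambleHilbertConstant`); pointwise values of the derivatives of `u` never enter. For `m ≥ 1`
the first-order estimate makes `u` Lipschitz on a set of full measure, and a Lipschitz extension of
it is the continuous representative (`MemSobolev.exists_lipschitz_ae_eq`).

For the quadrature error, the affine change of variables carries exactness over to the given
simplex, so a polynomial `p` of degree at most `m` contributes no error. The almost everywhere bound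
on `v - p` extends by continuity to the whole closed simplex, in particular to the nodes, and
bounds both the rule and the integral of `v - p`
(`QuadratureRule.IsExact.abs_apply_sub_integral_le`).
-/

open Filter Topology

/-! ### Weak derivatives -/

/-- A locally integrable function times a continuous function with compact support in `Ω` is
integrable on `Ω`. -/
theorem integrableOn_mul_of_tsupport_subset {E : Type*} [NormedAddCommGroup E] [MeasurableSpace E]
    [BorelSpace E] {μ : Measure E} {Ω : Set E} {g φ : E → ℝ} (hΩ : MeasurableSet Ω)
    (hg : LocallyIntegrableOn g Ω μ) (hφ : Continuous φ) (hc : HasCompactSupport φ)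
    (hs : tsupport φ ⊆ Ω) : IntegrableOn (fun x => g x * φ x) Ω μ := by
  have h1 : IntegrableOn (fun x => g x * φ x) (tsupport φ) μ :=
    (hg.integrableOn_compact_subset hs hc).mul_continuousOn hφ.continuousOn hc
  refine h1.of_forall_sdiff_eq_zero hΩ fun x hx => ?_
  rw [image_eq_zero_of_notMem_tsupport hx.2, mul_zero]

namespace SimplexQuadrature

/-- Weak derivatives are unique up to null sets. -/
theorem HasWeakDeriv.ae_eq {n k : ℕ} {Ω : Set (EuclideanSpace ℝ (Fin n))}
    {u : EuclideanSpace ℝ (Fin n) → ℝ} {I : Fin k → Fin n} {g g' : EuclideanSpace ℝ (Fin n) → ℝ}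
    (hΩ : IsOpen Ω) (h : HasWeakDeriv Ω u I g) (h' : HasWeakDeriv Ω u I g') :
    g =ᵐ[volume.restrict Ω] g' := by
  have key := hΩ.ae_eq_zero_of_integral_contDiff_smul_eq_zero (μ := volume)
    (f := fun x => g x - g' x) (h.2.1.sub h'.2.1) fun φ hφ hc hs => by
      have e : ∫ x, φ x • (g x - g' x) = ∫ x in Ω, (g x * φ x - g' x * φ x) := by
        rw [← setIntegral_eq_integral_of_forall_compl_eq_zero (s := Ω)]
        · refine integral_congr_ae (ae_of_all _ fun x => ?_)
          simp only [smul_eq_mul]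
          ring
        · intro x hx
          rw [image_eq_zero_of_notMem_tsupport fun hx' => hx (hs hx'), zero_smul]
      rw [e, integral_sub
        (integrableOn_mul_of_tsupport_subset hΩ.measurableSet h.2.1 hφ.continuous hc hs)
        (integrableOn_mul_of_tsupport_subset hΩ.measurableSet h'.2.1 hφ.continuous hc hs)]
      have e1 := h.2.2 φ hφ hc hs
      rw [h'.2.2 φ hφ hc hs] at e1
      rw [mul_left_cancel₀ (pow_ne_zero k (by norm_num : (-1 : ℝ) ≠ 0)) e1, sub_self]
  rw [EventuallyEq, ae_restrict_iff' hΩ.measurableSet]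
  filter_upwards [key] with x hx hxΩ
  exact sub_eq_zero.mp (hx hxΩ)

theorem sobolevNorm_nonneg {n : ℕ} (m : ℕ) (Ω : Set (EuclideanSpace ℝ (Fin n)))
    (u : EuclideanSpace ℝ (Fin n) → ℝ) : 0 ≤ sobolevNorm m Ω u :=
  ENNReal.toReal_nonneg

/-- The Sobolev norm bounds every weak derivative almost everywhere. The chosen derivatives
`weakDeriv` are essentially bounded by uniqueness, so the supremum in the norm is finite and
`ENNReal.toReal` loses nothing. -/
theorem MemSobolev.exists_hasWeakDeriv_ae_le {n m : ℕ} {Ω : Set (EuclideanSpace ℝ (Fin n))}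
    {u : EuclideanSpace ℝ (Fin n) → ℝ} (hΩ : IsOpen Ω) (hu : MemSobolev m Ω u) {k : ℕ}
    (hk : k ≤ m) (I : Fin k → Fin n) :
    ∃ g, HasWeakDeriv Ω u I g ∧ ∀ᵐ x ∂(volume.restrict Ω), |g x| ≤ sobolevNorm m Ω u := by
  have hspec : ∀ j ≤ m, ∀ J : Fin j → Fin n, HasWeakDeriv Ω u J (weakDeriv Ω u J) ∧
      eLpNorm (weakDeriv Ω u J) ∞ (volume.restrict Ω) < ⊤ := by
    intro j hj J
    obtain ⟨g, hg, hgL⟩ := hu j hj J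
    have hex : ∃ g, HasWeakDeriv Ω u J g := ⟨g, hg⟩
    have hw : HasWeakDeriv Ω u J (weakDeriv Ω u J) := by
      rw [weakDeriv, dif_pos hex]
      exact hex.choose_spec
    refine ⟨hw, ?_⟩
    rw [eLpNorm_congr_ae (hw.ae_eq hΩ hg)]
    exact hgL.eLpNorm_lt_top
  refine ⟨weakDeriv Ω u I, (hspec k hk I).1, ?_⟩
  have hfin : (⨆ (k : Fin (m + 1)) (I : Fin (k : ℕ) → Fin n),
      eLpNorm (weakDeriv Ω u I) ∞ (volume.restrict Ω)) < ⊤ := by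
    rw [← Finset.sup_univ_eq_iSup, Finset.sup_lt_iff ENNReal.zero_lt_top]
    intro j _
    rw [← Finset.sup_univ_eq_iSup, Finset.sup_lt_iff ENNReal.zero_lt_top]
    exact fun J _ => (hspec j (Nat.lt_succ_iff.mp j.2) J).2
  filter_upwards [ae_le_eLpNormEssSup (f := weakDeriv Ω u I) (μ := volume.restrict Ω)] with x hx
  have h1 : ‖weakDeriv Ω u I x‖ₑ ≤ ⨆ (k : Fin (m + 1)) (I : Fin (k : ℕ) → Fin n),
      eLpNorm (weakDeriv Ω u I) ∞ (volume.restrict Ω) := by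
    rw [← eLpNorm_exponent_top] at hx
    exact hx.trans (le_iSup_of_le (⟨k, Nat.lt_succ_of_le hk⟩ : Fin (m + 1))
      (le_iSup (fun I : Fin k → Fin n => eLpNorm (weakDeriv Ω u I) ∞ (volume.restrict Ω)) I))
  have h2 := ENNReal.toReal_mono hfin.ne h1
  rwa [toReal_enorm, Real.norm_eq_abs] at h2

/-- The order-zero weak derivative is the function itself. -/
theorem MemSobolev.ae_abs_le {n m : ℕ} {Ω : Set (EuclideanSpace ℝ (Fin n))}
    {u : EuclideanSpace ℝ (Fin n) → ℝ} (hΩ : IsOpen Ω) (hu : MemSobolev m Ω u) :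
    ∀ᵐ x ∂(volume.restrict Ω), |u x| ≤ sobolevNorm m Ω u := by
  obtain ⟨g, hg, hgb⟩ := hu.exists_hasWeakDeriv_ae_le hΩ (Nat.zero_le m) Fin.elim0
  have hself : HasWeakDeriv Ω u (Fin.elim0 : Fin 0 → Fin n) u :=
    ⟨hg.1, hg.1, fun φ _ _ _ => by simp⟩
  filter_upwards [hgb, hg.ae_eq hΩ hself] with x hx hxe
  rwa [← hxe]

theorem MemSobolev.integrableOn {n m : ℕ} {Ω : Set (EuclideanSpace ℝ (Fin n))}
    {u : EuclideanSpace ℝ (Fin n) → ℝ} (hΩ : IsOpen Ω) (hb : Bornology.IsBounded Ω)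
    (hu : MemSobolev m Ω u) : IntegrableOn u Ω := by
  obtain ⟨g, hg, -⟩ := hu 0 (Nat.zero_le m) Fin.elim0
  refine IntegrableOn.of_bound hb.measure_lt_top hg.1.aestronglyMeasurable
    (sobolevNorm m Ω u) ?_
  simpa only [Real.norm_eq_abs] using hu.ae_abs_le hΩ

end SimplexQuadrature

/-! ### Derivatives of mollifications -/

open scoped Convolution in
/-- Derivatives of a convolution fall on the smooth factor. -/
theorem iteratedFDeriv_convolution_left_apply {E : Type*} [NormedAddCommGroup E]
    [NormedSpace ℝ E] [MeasurableSpace E] [BorelSpace E] {μ : Measure E}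
    [SFinite μ] [μ.IsAddLeftInvariant] [μ.IsNegInvariant] {φ u : E → ℝ} (hφ : ContDiff ℝ ∞ φ)
    (hc : HasCompactSupport φ) (hu : LocallyIntegrable u μ) (k : ℕ) (w : Fin k → E) (x : E) :
    iteratedFDeriv ℝ k (φ ⋆[ContinuousLinearMap.lsmul ℝ ℝ, μ] u) x w =
      ((fun z => iteratedFDeriv ℝ k φ z w) ⋆[ContinuousLinearMap.lsmul ℝ ℝ, μ] u) x := by
  induction k generalizing x with
  | zero => simp
  | succ k ih =>
    have hF : ContDiff ℝ ∞ (φ ⋆[ContinuousLinearMap.lsmul ℝ ℝ, μ] u) :=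
      hc.contDiff_convolution_left _ hφ hu
    have hsm : ∀ {f : E → ℝ}, ContDiff ℝ ∞ f → ContDiff ℝ 1 (iteratedFDeriv ℝ k f) :=
      fun hf => hf.iteratedFDeriv_right (by exact_mod_cast le_top)
    have hψ : ContDiff ℝ 1 (fun z => iteratedFDeriv ℝ k φ z (Fin.tail w)) :=
      (ContinuousMultilinearMap.apply ℝ (fun _ : Fin k => E) ℝ (Fin.tail w)).contDiff.comp (hsm hφ)
    have hψc : HasCompactSupport (fun z => iteratedFDeriv ℝ k φ z (Fin.tail w)) :=
      (hc.iteratedFDeriv (𝕜 := ℝ) k).comp_left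
        (g := fun L : E [×k]→L[ℝ] ℝ => L (Fin.tail w)) rfl
    -- directional derivatives commute with evaluation at the remaining directions
    have hev : ∀ {f : E → ℝ}, ContDiff ℝ ∞ f → ∀ y, iteratedFDeriv ℝ (k + 1) f y w =
        fderiv ℝ (fun z => iteratedFDeriv ℝ k f z (Fin.tail w)) y (w 0) := by
      intro f hf y
      have h := ((hsm hf).differentiable one_ne_zero y).hasFDerivAt
      have h2 := (ContinuousMultilinearMap.apply ℝ (fun _ : Fin k => E) ℝ
        (Fin.tail w)).hasFDerivAt.comp y h
      rw [iteratedFDeriv_succ_apply_left]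
      have h3 := h2.fderiv
      have h4 : ((ContinuousMultilinearMap.apply ℝ (fun _ : Fin k => E) ℝ (Fin.tail w)) ∘
        (iteratedFDeriv ℝ k f)) = fun z => iteratedFDeriv ℝ k f z (Fin.tail w) := rfl
      rw [h4] at h3
      rw [h3]
      rfl
    rw [hev hF, funext (ih (Fin.tail w)),
      (hψc.hasFDerivAt_convolution_left (ContinuousLinearMap.lsmul ℝ ℝ) hψ hu x).fderiv]
    have hint : ConvolutionExistsAt (fderiv ℝ fun z => iteratedFDeriv ℝ k φ z (Fin.tail w)) u x
        ((ContinuousLinearMap.lsmul ℝ ℝ).precompL E) μ :=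
      (hψc.fderiv (𝕜 := ℝ)).convolutionExists_left _ (hψ.continuous_fderiv one_ne_zero) hu x
    rw [convolution_def, ContinuousLinearMap.integral_apply hint, convolution_def]
    refine integral_congr_ae (ae_of_all _ fun t => ?_)
    simp [hev hφ, ContinuousLinearMap.precompL_apply]

/-- Reflecting a function changes its `k`-th derivatives by the sign `(-1) ^ k`. -/
theorem iteratedFDeriv_comp_const_sub_apply {E : Type*} [NormedAddCommGroup E]
    [NormedSpace ℝ E] {φ : E → ℝ} (hφ : ContDiff ℝ ∞ φ) (k : ℕ) (x y : E) (w : Fin k → E) :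
    iteratedFDeriv ℝ k (fun z => φ (x - z)) y w =
      (-1) ^ k * iteratedFDeriv ℝ k φ (x - y) w := by
  have h1 : (fun z => φ (x - z)) =
      (fun z => φ (z + x)) ∘ ((-ContinuousLinearMap.id ℝ E : E →L[ℝ] E)) := by
    ext z
    simp [sub_eq_neg_add]
  have h2 : ContDiff ℝ ∞ (fun z => φ (z + x)) := hφ.comp (contDiff_id.add contDiff_const)
  rw [h1, ContinuousLinearMap.iteratedFDeriv_comp_right _ h2 y (i := k) (by exact_mod_cast le_top),
    iteratedFDeriv_comp_add_right]
  rw [ContinuousMultilinearMap.compContinuousLinearMap_apply]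
  have h3 : (fun i => (-ContinuousLinearMap.id ℝ E : E →L[ℝ] E) (w i)) =
      fun i => (-1 : ℝ) • w i := by
    ext i
    simp
  rw [h3, ContinuousMultilinearMap.map_smul_univ]
  simp [sub_eq_neg_add]

namespace SimplexQuadrature

open scoped Convolution in
/-- Mollification does not increase a bound on a weak derivative: at points whose distance to the
complement of `Ω` exceeds the radius of the mollifier, the derivative of the mollified function
is an average of the weak derivative. -/
theorem HasWeakDeriv.abs_iteratedFDeriv_convolution_le {n k : ℕ}
    {Ω : Set (EuclideanSpace ℝ (Fin n))} {u : EuclideanSpace ℝ (Fin n) → ℝ} {I : Fin k → Fin n}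
    {g : EuclideanSpace ℝ (Fin n) → ℝ} {M : ℝ} (hΩ : IsOpen Ω) (hu : IntegrableOn u Ω)
    (h : HasWeakDeriv Ω u I g) (hM : 0 ≤ M) (hg : ∀ᵐ x ∂(volume.restrict Ω), |g x| ≤ M)
    (φ : ContDiffBump (0 : EuclideanSpace ℝ (Fin n))) {x : EuclideanSpace ℝ (Fin n)}
    (hx : Metric.closedBall x φ.rOut ⊆ Ω) :
    |iteratedFDeriv ℝ k
        (φ.normed volume ⋆[ContinuousLinearMap.lsmul ℝ ℝ, volume] Ω.indicator u) x
        (fun j => EuclideanSpace.single (I j) (1 : ℝ))| ≤ M := by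
  have hφ : ContDiff ℝ ∞ (φ.normed volume) := φ.contDiff_normed
  have hc : HasCompactSupport (φ.normed volume) := φ.hasCompactSupport_normed
  rw [iteratedFDeriv_convolution_left_apply hφ hc
    ((integrable_indicator_iff hΩ.measurableSet).mpr hu).locallyIntegrable, convolution_eq_swap]
  set ψ : EuclideanSpace ℝ (Fin n) → ℝ := fun z => φ.normed volume (x - z) with hψ
  have hψs : ContDiff ℝ ∞ ψ := hφ.comp (contDiff_const.sub contDiff_id)
  have hψt : tsupport ψ ⊆ Metric.closedBall x φ.rOut := by
    refine closure_minimal (fun z hz => ?_) Metric.isClosed_closedBall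
    have hz' : x - z ∈ Function.support (φ.normed volume) := hz
    rw [φ.support_normed_eq] at hz'
    rw [Metric.mem_closedBall, dist_comm, dist_eq_norm]
    exact (mem_ball_zero_iff.mp hz').le
  have hψc : HasCompactSupport ψ :=
    HasCompactSupport.of_support_subset_isCompact (isCompact_closedBall x φ.rOut)
      (subset_closure.trans hψt)
  have hw := h.2.2 ψ hψs hψc (hψt.trans hx)
  -- the sign from reflecting the mollifier cancels the sign in the definition of weak derivative
  have e : ∫ t, (ContinuousLinearMap.lsmul ℝ ℝ (iteratedFDeriv ℝ k (φ.normed volume) (x - t)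
        (fun j => EuclideanSpace.single (I j) (1 : ℝ)))) (Ω.indicator u t) =
      ∫ t in Ω, g t * ψ t := by
    have e1 : ∀ t, (ContinuousLinearMap.lsmul ℝ ℝ (iteratedFDeriv ℝ k (φ.normed volume) (x - t)
        (fun j => EuclideanSpace.single (I j) (1 : ℝ)))) (Ω.indicator u t) =
        Ω.indicator (fun t => (-1) ^ k * (u t * iteratedFDeriv ℝ k ψ t
          (fun j => EuclideanSpace.single (I j) (1 : ℝ)))) t := by
      intro t
      by_cases ht : t ∈ Ω
      · rw [Set.indicator_of_mem ht, Set.indicator_of_mem ht, hψ,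
          iteratedFDeriv_comp_const_sub_apply hφ, ContinuousLinearMap.lsmul_apply, smul_eq_mul]
        have : ((-1 : ℝ) ^ k) * (-1) ^ k = 1 := by rw [← mul_pow]; norm_num
        linear_combination (-(iteratedFDeriv ℝ k (φ.normed volume) (x - t)
          (fun j => EuclideanSpace.single (I j) (1 : ℝ))) * u t) * this
      · rw [Set.indicator_of_notMem ht, Set.indicator_of_notMem ht, map_zero]
    rw [integral_congr_ae (ae_of_all _ e1), integral_indicator hΩ.measurableSet,
      integral_const_mul, hw, ← mul_assoc, ← mul_pow]
    norm_num
  rw [e]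
  have hψi : Integrable ψ := hψs.continuous.integrable_of_hasCompactSupport hψc
  have hψ0 : ∀ z, 0 ≤ ψ z := fun z => φ.nonneg_normed _
  have hψ1 : ∫ z, ψ z = 1 := by
    rw [hψ, integral_sub_left_eq_self (φ.normed volume) volume x]
    exact φ.integral_normed
  calc |∫ t in Ω, g t * ψ t| ≤ ∫ t in Ω, M * ψ t := by
        rw [← Real.norm_eq_abs]
        refine norm_integral_le_of_norm_le (hψi.integrableOn.const_mul M) ?_
        filter_upwards [hg] with t ht
        rw [norm_mul, Real.norm_eq_abs, Real.norm_of_nonneg (hψ0 t)]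
        exact mul_le_mul_of_nonneg_right ht (hψ0 t)
    _ = M * ∫ t in Ω, ψ t := integral_const_mul _ _
    _ ≤ M * ∫ t, ψ t := mul_le_mul_of_nonneg_left
        (setIntegral_le_integral hψi (ae_of_all _ hψ0)) hM
    _ = M := by rw [hψ1, mul_one]

end SimplexQuadrature

/-! ### Taylor polynomials with bounded remainder -/

/-- The value of a multilinear form on the diagonal, expanded in coordinates. -/
theorem ContinuousMultilinearMap.apply_const_eq_sum_single {n k : ℕ}
    (L : (EuclideanSpace ℝ (Fin n)) [×k]→L[ℝ] ℝ) (h : EuclideanSpace ℝ (Fin n)) :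
    L (fun _ => h) = ∑ I : Fin k → Fin n,
      (∏ j, h (I j)) * L (fun j => EuclideanSpace.single (I j) (1 : ℝ)) := by
  have hh : h = ∑ i, h i • EuclideanSpace.single i (1 : ℝ) := by
    ext j
    simp [Pi.single_apply]
  have e : L (fun _ => h) = L (fun _ => ∑ i, h i • EuclideanSpace.single i (1 : ℝ)) := by
    rw [← hh]
  rw [e, L.map_sum]
  refine Finset.sum_congr rfl fun I _ => ?_
  rw [L.map_smul_univ, smul_eq_mul]

theorem iteratedDeriv_comp_line {E : Type*} [NormedAddCommGroup E] [NormedSpace ℝ E] {f : E → ℝ}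
    (hf : ContDiff ℝ ∞ f) (k : ℕ) (a h : E) (t : ℝ) :
    iteratedDeriv k (fun s : ℝ => f (a + s • h)) t =
      iteratedFDeriv ℝ k f (a + t • h) (fun _ => h) := by
  have h1 : (fun s : ℝ => f (a + s • h)) =
      (fun z => f (z + a)) ∘ (ContinuousLinearMap.toSpanSingleton ℝ h) := by
    ext s
    simp [add_comm]
  have h2 : ContDiff ℝ ∞ (fun z => f (z + a)) := hf.comp (contDiff_id.add contDiff_const)
  rw [iteratedDeriv_eq_iteratedFDeriv, h1,
    ContinuousLinearMap.iteratedFDeriv_comp_right _ h2 t (i := k) (by exact_mod_cast le_top),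
    iteratedFDeriv_comp_add_right, ContinuousMultilinearMap.compContinuousLinearMap_apply]
  simp [add_comm]

/-- The polynomial `∑_{k < m} (1 / k!) ∑_I c_{k,I} ∏_j (X_{I j} - a_{I j})` with prescribed
derivatives `c` at `a`, multi-indices being lists of directions. -/
noncomputable def taylorPoly {n : ℕ} (m : ℕ) (a : EuclideanSpace ℝ (Fin n))
    (c : (Σ k : Fin m, Fin (k : ℕ) → Fin n) → ℝ) : MvPolynomial (Fin n) ℝ :=
  ∑ i : (Σ k : Fin m, Fin (k : ℕ) → Fin n),
    MvPolynomial.C ((Nat.factorial i.1 : ℝ)⁻¹ * c i) *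
      ∏ j, (MvPolynomial.X (i.2 j) - MvPolynomial.C (a (i.2 j)))

theorem totalDegree_taylorPoly_le {n : ℕ} (m : ℕ) (a : EuclideanSpace ℝ (Fin n))
    (c : (Σ k : Fin m, Fin (k : ℕ) → Fin n) → ℝ) : (taylorPoly m a c).totalDegree ≤ m := by
  refine MvPolynomial.totalDegree_finsetSum_le fun i _ => ?_
  refine (MvPolynomial.totalDegree_mul _ _).trans ?_
  rw [MvPolynomial.totalDegree_C, zero_add]
  refine (MvPolynomial.totalDegree_finsetProd _ _).trans ?_
  refine (Finset.sum_le_card_nsmul _ _ 1 fun j _ => ?_).trans ?_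
  · refine (MvPolynomial.totalDegree_sub _ _).trans ?_
    rw [MvPolynomial.totalDegree_C, MvPolynomial.totalDegree_X]
    exact (max_eq_left zero_le_one).le
  · simp

theorem eval_taylorPoly {n : ℕ} (m : ℕ) (a : EuclideanSpace ℝ (Fin n))
    (c : (Σ k : Fin m, Fin (k : ℕ) → Fin n) → ℝ) (x : EuclideanSpace ℝ (Fin n)) :
    MvPolynomial.eval (fun i => x i) (taylorPoly m a c) =
      ∑ i : (Σ k : Fin m, Fin (k : ℕ) → Fin n),
        (Nat.factorial i.1 : ℝ)⁻¹ * c i * ∏ j, (x (i.2 j) - a (i.2 j)) := by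
  simp [taylorPoly]

theorem continuous_eval_taylorPoly {n : ℕ} (m : ℕ) (a x : EuclideanSpace ℝ (Fin n)) :
    Continuous fun c => MvPolynomial.eval (fun i => x i) (taylorPoly m a c) := by
  simp only [eval_taylorPoly]
  fun_prop

/-- If the derivatives of order `m` are bounded by `M` along the segment from `a` to `x`, then the
Taylor polynomial of degree less than `m` at `a` approximates `f x` up to `n ^ m d ^ m M`. -/
theorem abs_sub_eval_taylorPoly_le {n : ℕ} {f : EuclideanSpace ℝ (Fin n) → ℝ}
    (hf : ContDiff ℝ ∞ f) (m : ℕ) {a x : EuclideanSpace ℝ (Fin n)} {d M : ℝ}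
    (hd : dist x a ≤ d)
    (hM : ∀ y ∈ segment ℝ a x, ∀ I : Fin m → Fin n,
      |iteratedFDeriv ℝ m f y (fun j => EuclideanSpace.single (I j) (1 : ℝ))| ≤ M) :
    |f x - MvPolynomial.eval (fun i => x i) (taylorPoly m a fun i =>
        iteratedFDeriv ℝ i.1 f a (fun j => EuclideanSpace.single (i.2 j) (1 : ℝ)))| ≤
      (n : ℝ) ^ m * d ^ m * M := by
  set h := x - a with hh
  have hhi : ∀ i, |h i| ≤ d := fun i =>
    (PiLp.norm_apply_le h i).trans (by rwa [hh, ← dist_eq_norm])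
  have hbound : ∀ y ∈ segment ℝ a x, |iteratedFDeriv ℝ m f y (fun _ => h)| ≤
      (n : ℝ) ^ m * d ^ m * M := by
    intro y hy
    rw [ContinuousMultilinearMap.apply_const_eq_sum_single]
    refine (Finset.abs_sum_le_sum_abs _ _).trans ?_
    refine (Finset.sum_le_card_nsmul _ _ (d ^ m * M) fun I _ => ?_).trans (le_of_eq ?_)
    · rw [abs_mul, Finset.abs_prod]
      refine mul_le_mul ?_ (hM y hy I) (abs_nonneg _) (pow_nonneg (dist_nonneg.trans hd) m)
      refine (Finset.prod_le_prod (fun j _ => abs_nonneg _) fun j _ => hhi (I j)).trans ?_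
      simp
    · simp [mul_assoc]
  -- the one-variable remainder bound needs order at least one; for `m = 0` the polynomial is zero
  rcases m with _ | m
  · have e : taylorPoly 0 a (fun i => iteratedFDeriv ℝ i.1 f a
        (fun j => EuclideanSpace.single (i.2 j) (1 : ℝ))) = 0 := by
      simp [taylorPoly]
    rw [e, map_zero, sub_zero]
    simpa using hbound x (right_mem_segment ℝ a x)
  set g : ℝ → ℝ := fun s => f (a + s • h) with hg
  have hgs : ContDiff ℝ ∞ g := hf.comp (contDiff_const.add (contDiff_id.smul contDiff_const))
  have hgd : ∀ k, ∀ t ∈ Set.Icc (0 : ℝ) 1, iteratedDerivWithin k g (Set.Icc 0 1) t =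
      iteratedFDeriv ℝ k f (a + t • h) (fun _ => h) := by
    intro k t ht
    rw [iteratedDerivWithin_eq_iteratedDeriv (uniqueDiffOn_Icc zero_lt_one)
      (hgs.contDiffAt.of_le (by exact_mod_cast le_top)) ht, hg, iteratedDeriv_comp_line hf]
  have hT := taylor_mean_remainder_bound (f := g) (a := 0) (b := 1) (x := 1) (n := m)
    (C := (n : ℝ) ^ (m + 1) * d ^ (m + 1) * M) zero_le_one
    (hgs.contDiffOn.of_le (by exact_mod_cast le_top)) (Set.right_mem_Icc.mpr zero_le_one)
    (fun t ht => by
      rw [hgd _ t ht, Real.norm_eq_abs]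
      refine hbound _ ?_
      rw [segment_eq_image']
      exact ⟨t, ht, rfl⟩)
  have e1 : g 1 = f x := by simp [hg, hh]
  have e2 : taylorWithinEval g m (Set.Icc 0 1) 0 1 =
      MvPolynomial.eval (fun i => x i) (taylorPoly (m + 1) a fun i =>
        iteratedFDeriv ℝ i.1 f a (fun j => EuclideanSpace.single (i.2 j) (1 : ℝ))) := by
    rw [taylor_within_apply, eval_taylorPoly, Fintype.sum_sigma, ← Fin.sum_univ_eq_sum_range
      (fun k => ((k.factorial : ℝ)⁻¹ * (1 - 0) ^ k) • iteratedDerivWithin k g (Set.Icc 0 1) 0)]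
    refine Finset.sum_congr rfl fun k _ => ?_
    rw [hgd _ 0 (Set.left_mem_Icc.mpr zero_le_one), zero_smul, add_zero,
      ContinuousMultilinearMap.apply_const_eq_sum_single, Finset.smul_sum]
    refine Finset.sum_congr rfl fun I _ => ?_
    simp only [sub_zero, one_pow, mul_one, smul_eq_mul, hh, PiLp.sub_apply]
    ring
  rw [e1, e2, Real.norm_eq_abs] at hT
  refine hT.trans ?_
  have h0 : 0 ≤ (n : ℝ) ^ (m + 1) * d ^ (m + 1) * M :=
    (abs_nonneg _).trans (hbound a (left_mem_segment ℝ a x))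
  rw [sub_zero, one_pow, mul_one]
  exact div_le_self h0 (by exact_mod_cast Nat.one_le_iff_ne_zero.mpr m.factorial_ne_zero)

/-! ### Approximation by smooth functions, Bramble–Hilbert and Lipschitz representatives -/

namespace SimplexQuadrature

/-- A function of `W^m_∞(Ω)` is the almost everywhere limit of smooth functions whose derivatives
of order at most `m` are, on every compact subset of `Ω`, eventually bounded by its norm. -/
theorem MemSobolev.exists_smooth_approx {n m : ℕ} {Ω : Set (EuclideanSpace ℝ (Fin n))}
    {u : EuclideanSpace ℝ (Fin n) → ℝ} (hΩ : IsOpen Ω) (hb : Bornology.IsBounded Ω)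
    (hu : MemSobolev m Ω u) :
    ∃ f : ℕ → EuclideanSpace ℝ (Fin n) → ℝ, (∀ i, ContDiff ℝ ∞ (f i)) ∧
      (∀ᵐ x ∂(volume.restrict Ω), Tendsto (fun i => f i x) atTop (𝓝 (u x))) ∧
      ∀ K ⊆ Ω, IsCompact K → ∀ᶠ i in atTop, ∀ x ∈ K, ∀ k ≤ m, ∀ I : Fin k → Fin n,
        |iteratedFDeriv ℝ k (f i) x (fun j => EuclideanSpace.single (I j) (1 : ℝ))| ≤
          sobolevNorm m Ω u := by
  have hui := hu.integrableOn hΩ hb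
  have hloc : LocallyIntegrable (Ω.indicator u) :=
    ((integrable_indicator_iff hΩ.measurableSet).mpr hui).locallyIntegrable
  -- radii with a fixed ratio, so that the mollified functions converge at every Lebesgue point
  let φ : ℕ → ContDiffBump (0 : EuclideanSpace ℝ (Fin n)) := fun i =>
    { rIn := 1 / ((i : ℝ) + 1)
      rOut := 2 * (1 / ((i : ℝ) + 1))
      rIn_pos := Nat.one_div_pos_of_nat
      rIn_lt_rOut := lt_two_mul_self Nat.one_div_pos_of_nat }
  have hφ : Tendsto (fun i => (φ i).rOut) atTop (𝓝 0) := by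
    simpa [φ] using (tendsto_one_div_add_atTop_nhds_zero_nat (𝕜 := ℝ)).const_mul 2
  refine ⟨fun i => convolution ((φ i).normed volume) (Ω.indicator u)
    (ContinuousLinearMap.lsmul ℝ ℝ) volume, fun i => ?_, ?_, fun K hK hKc => ?_⟩
  · exact (φ i).hasCompactSupport_normed.contDiff_convolution_left _ (φ i).contDiff_normed hloc
  · rw [ae_restrict_iff' hΩ.measurableSet]
    filter_upwards [ContDiffBump.ae_convolution_tendsto_right_of_locallyIntegrable (K := 2) hφ
      (Eventually.of_forall fun i => le_rfl) hloc] with x hx hxΩ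
    rwa [Set.indicator_of_mem hxΩ] at hx
  · obtain ⟨δ, hδ, hδK⟩ := hKc.exists_cthickening_subset_open hΩ hK
    filter_upwards [hφ.eventually_le_const hδ] with i hi x hx k hk I
    obtain ⟨g, hg, hgb⟩ := hu.exists_hasWeakDeriv_ae_le hΩ hk I
    refine hg.abs_iteratedFDeriv_convolution_le hΩ hui (sobolevNorm_nonneg m Ω u) hgb (φ i) ?_
    exact (Metric.closedBall_subset_closedBall hi).trans
      ((Metric.closedBall_subset_cthickening hx δ).trans hδK)

theorem dist_le_enclosingDiam {n : ℕ} {Ω : Set (EuclideanSpace ℝ (Fin n))}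
    (hb : Bornology.IsBounded Ω) {x y : EuclideanSpace ℝ (Fin n)} (hx : x ∈ Ω) (hy : y ∈ Ω) :
    dist x y ≤ enclosingDiam Ω := by
  have h : dist x y / 2 ≤ sInf {r : ℝ | 0 ≤ r ∧ ∃ c, Ω ⊆ Metric.closedBall c r} := by
    refine le_csInf ?_ ?_
    · obtain ⟨r, hr⟩ := hb.subset_closedBall x
      exact ⟨r, dist_nonneg.trans (hr hx), x, hr⟩
    · rintro r ⟨-, c, hc⟩
      have := dist_triangle_right x y c
      have h1 : dist x c ≤ r := hc hx
      have h2 : dist y c ≤ r := hc hy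
      linarith
  rw [enclosingDiam]
  linarith

/-- The constant `n ^ m` serves for every chunkiness. The Taylor polynomials of the mollified
functions at a fixed point have bounded coefficients, so a subsequence converges, and its limit is
the required polynomial. -/
theorem isBrambleHilbertConstant (m n : ℕ) (γ : ℝ) :
    IsBrambleHilbertConstant m n γ ((n : ℝ) ^ m) := by
  rintro Ω ⟨a, ha⟩ hb hΩ hconv - u hu
  obtain ⟨f, hf, hlim, hbd⟩ := hu.exists_smooth_approx hΩ hb
  set N := sobolevNorm m Ω u
  let c : ℕ → (Σ k : Fin m, Fin (k : ℕ) → Fin n) → ℝ := fun i J =>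
    iteratedFDeriv ℝ J.1 (f i) a (fun j => EuclideanSpace.single (J.2 j) (1 : ℝ))
  have hc : ∀ᶠ i in atTop, c i ∈ Set.univ.pi fun _ => Set.Icc (-N) N := by
    filter_upwards [hbd {a} (Set.singleton_subset_iff.mpr ha) isCompact_singleton] with i hi J _
    exact abs_le.mp (hi a rfl J.1 J.1.2.le J.2)
  obtain ⟨b, -, s, hs, hsb⟩ := (isCompact_univ_pi fun _ => isCompact_Icc).tendsto_subseq'
    hc.frequently
  refine ⟨taylorPoly m a b, totalDegree_taylorPoly_le m a b, ?_⟩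
  filter_upwards [hlim, ae_restrict_mem hΩ.measurableSet] with x hx hxΩ
  have hseg : segment ℝ a x ⊆ Ω := hconv.segment_subset ha hxΩ
  have hsegc : IsCompact (segment ℝ a x) := by
    rw [segment_eq_image_lineMap]
    exact isCompact_Icc.image AffineMap.lineMap_continuous
  have ht : Tendsto (fun i => |f (s i) x -
      MvPolynomial.eval (fun i => x i) (taylorPoly m a (c (s i)))|) atTop
      (𝓝 |u x - MvPolynomial.eval (fun i => x i) (taylorPoly m a b)|) :=
    ((hx.comp hs.tendsto_atTop).sub
      (((continuous_eval_taylorPoly m a x).tendsto b).comp hsb)).abs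
  have hev : ∀ᶠ i in atTop, |f i x -
      MvPolynomial.eval (fun i => x i) (taylorPoly m a (c i))| ≤
        (n : ℝ) ^ m * enclosingDiam Ω ^ m * N := by
    filter_upwards [hbd _ hseg hsegc] with i hi
    exact abs_sub_eval_taylorPoly_le (hf i) m (dist_le_enclosingDiam hb hxΩ ha)
      fun y hy I => hi y hy m le_rfl I
  exact le_of_tendsto ht (hs.tendsto_atTop.eventually hev)

/-- On a convex domain a function with bounded first derivatives has a Lipschitz
representative. -/
theorem MemSobolev.exists_lipschitz_ae_eq {n m : ℕ} (hm : 1 ≤ m)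
    {Ω : Set (EuclideanSpace ℝ (Fin n))} {u : EuclideanSpace ℝ (Fin n) → ℝ} (hΩ : IsOpen Ω)
    (hb : Bornology.IsBounded Ω) (hconv : Convex ℝ Ω) (hu : MemSobolev m Ω u) :
    ∃ v, (∃ K, LipschitzWith K v) ∧ v =ᵐ[volume.restrict Ω] u := by
  obtain ⟨f, hf, hlim, hbd⟩ := hu.exists_smooth_approx hΩ hb
  set N := sobolevNorm m Ω u
  have hN : 0 ≤ N := sobolevNorm_nonneg m Ω u
  have hlip : LipschitzOnWith (Real.toNNReal (n * N)) u
      {x | x ∈ Ω ∧ Tendsto (fun i => f i x) atTop (𝓝 (u x))} := by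
    refine LipschitzOnWith.of_dist_le_mul ?_
    rintro x ⟨hx, hxl⟩ y ⟨hy, hyl⟩
    rw [Real.coe_toNNReal _ (by positivity)]
    have hsegc : IsCompact (segment ℝ y x) := by
      rw [segment_eq_image_lineMap]
      exact isCompact_Icc.image AffineMap.lineMap_continuous
    refine le_of_tendsto (hxl.dist hyl) ?_
    filter_upwards [hbd _ (hconv.segment_subset hy hx) hsegc] with i hi
    have h := abs_sub_eval_taylorPoly_le (hf i) 1 (le_refl (dist x y))
      fun z hz I => hi z hz 1 hm I
    have e : MvPolynomial.eval (fun i => x i) (taylorPoly 1 y fun J =>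
        iteratedFDeriv ℝ J.1 (f i) y (fun j => EuclideanSpace.single (J.2 j) (1 : ℝ))) =
        f i y := by
      rw [eval_taylorPoly, Fintype.sum_sigma]
      simp
    rw [e, pow_one, pow_one] at h
    rw [Real.dist_eq]
    linarith
  obtain ⟨v, hv, hvu⟩ := hlip.extend_real
  refine ⟨v, ⟨_, hv⟩, ?_⟩
  filter_upwards [hlim, ae_restrict_mem hΩ.measurableSet] with x hx hxΩ
  exact (hvu ⟨hxΩ, hx⟩).symm

end SimplexQuadrature

/-! ### Simplices and the affine change of variables -/

namespace SimplexQuadrature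

theorem det_toEuclideanLin {n : ℕ} (A : Matrix (Fin n) (Fin n) ℝ) :
    LinearMap.det (Matrix.toEuclideanLin A) = A.det := by
  rw [Matrix.toEuclideanLin_eq_toLin_orthonormal, LinearMap.det_toLin]

theorem refMap_apply_coord {n : ℕ} (T : Affine.Simplex ℝ (EuclideanSpace ℝ (Fin n)) n)
    (x : EuclideanSpace ℝ (Fin n)) (i : Fin n) :
    refMap T x i = T.points 0 i + ∑ j, edgeMatrix T i j * x j := by
  simp [refMap, Matrix.mulVec, dotProduct]

theorem refMap_eq_sum {n : ℕ} (T : Affine.Simplex ℝ (EuclideanSpace ℝ (Fin n)) n)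
    (x : EuclideanSpace ℝ (Fin n)) :
    refMap T x = (1 - ∑ j, x j) • T.points 0 + ∑ j : Fin n, x j • T.points j.succ := by
  ext i
  rw [refMap_apply_coord]
  simp only [edgeMatrix, Matrix.of_apply, PiLp.add_apply, PiLp.smul_apply, smul_eq_mul,
    WithLp.ofLp_sum, Finset.sum_apply, sub_mul, Finset.sum_sub_distrib, one_mul, Finset.sum_mul]
  simp only [mul_comm]
  ring

open scoped Pointwise in
theorem refMap_image_eq_vadd {n : ℕ} (T : Affine.Simplex ℝ (EuclideanSpace ℝ (Fin n)) n)
    (S : Set (EuclideanSpace ℝ (Fin n))) :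
    refMap T '' S = T.points 0 +ᵥ (Matrix.toEuclideanLin (edgeMatrix T) '' S) := by
  rw [← Set.image_vadd, Set.image_image]
  rfl

theorem convex_standardSimplex (n : ℕ) : Convex ℝ (standardSimplex n) := by
  rintro x ⟨hx0, hx1⟩ y ⟨hy0, hy1⟩ s t hs ht hst
  refine ⟨fun i => ?_, ?_⟩
  · simpa using add_nonneg (mul_nonneg hs (hx0 i)) (mul_nonneg ht (hy0 i))
  · simp only [PiLp.add_apply, PiLp.smul_apply, smul_eq_mul, Finset.sum_add_distrib,
      ← Finset.mul_sum]
    nlinarith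

theorem isClosed_standardSimplex (n : ℕ) : IsClosed (standardSimplex n) := by
  have h : standardSimplex n = (⋂ i, {x | 0 ≤ x i}) ∩ {x | ∑ i, x i ≤ 1} := by
    ext x
    simp [standardSimplex]
  rw [h]
  refine (isClosed_iInter fun i => isClosed_le continuous_const (by fun_prop)).inter
    (isClosed_le (by fun_prop) continuous_const)

theorem refMap_image_standardSimplex {n : ℕ}
    (T : Affine.Simplex ℝ (EuclideanSpace ℝ (Fin n)) n) :
    refMap T '' standardSimplex n = closedSimplex T := by
  refine Set.Subset.antisymm ?_ (convexHull_min ?_ ?_)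
  · rintro _ ⟨x, ⟨hx0, hx1⟩, rfl⟩
    have h := (convex_convexHull ℝ (Set.range T.points)).sum_mem (t := Finset.univ)
      (w := Fin.cons (1 - ∑ j, x j) fun j => x j) (z := T.points)
      (fun i _ => Fin.cases (by simpa using hx1) (fun j => by simpa using hx0 j) i)
      (by simp [Fin.sum_univ_succ]) fun i _ => subset_convexHull ℝ _ (Set.mem_range_self i)
    rw [refMap_eq_sum]
    rw [Fin.sum_univ_succ] at h
    exact h
  · rintro _ ⟨i, rfl⟩
    refine Fin.cases ?_ (fun j => ?_) i
    · exact ⟨0, ⟨by simp, by simp⟩, by simp [refMap_eq_sum]⟩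
    · refine ⟨EuclideanSpace.single j 1, ⟨fun i => ?_, by simp⟩, ?_⟩
      · by_cases h : i = j <;> simp [h]
      · simp [refMap_eq_sum]
  · rw [refMap_image_eq_vadd]
    exact ((convex_standardSimplex n).linear_image _).vadd _

theorem volume_closedSimplex {n : ℕ} (T : Affine.Simplex ℝ (EuclideanSpace ℝ (Fin n)) n) :
    volume (closedSimplex T) =
      ENNReal.ofReal |(edgeMatrix T).det| * volume (standardSimplex n) := by
  rw [← refMap_image_standardSimplex, refMap_image_eq_vadd, measure_vadd,
    Measure.addHaar_image_linearMap, det_toEuclideanLin]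

theorem isCompact_closedSimplex {n : ℕ} (T : Affine.Simplex ℝ (EuclideanSpace ℝ (Fin n)) n) :
    IsCompact (closedSimplex T) :=
  (Set.finite_range T.points).isCompact_convexHull ℝ

theorem convex_closedSimplex {n : ℕ} (T : Affine.Simplex ℝ (EuclideanSpace ℝ (Fin n)) n) :
    Convex ℝ (closedSimplex T) :=
  convex_convexHull ℝ _

theorem nonempty_openSimplex {n : ℕ} (T : Affine.Simplex ℝ (EuclideanSpace ℝ (Fin n)) n) :
    (openSimplex T).Nonempty :=
  interior_convexHull_nonempty_iff_affineSpan_eq_top.mpr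
    (T.span_eq_top finrank_euclideanSpace_fin)

theorem openSimplex_ae_eq_closedSimplex {n : ℕ}
    (T : Affine.Simplex ℝ (EuclideanSpace ℝ (Fin n)) n) :
    openSimplex T =ᵐ[volume] closedSimplex T :=
  interior_ae_eq_of_null_frontier ((convex_closedSimplex T).addHaar_frontier volume)

theorem volume_real_openSimplex {n : ℕ} (T : Affine.Simplex ℝ (EuclideanSpace ℝ (Fin n)) n) :
    volume.real (openSimplex T) =
      |(edgeMatrix T).det| * volume.real (standardSimplex n) := by
  rw [measureReal_congr (openSimplex_ae_eq_closedSimplex T), Measure.real, volume_closedSimplex,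
    ENNReal.toReal_mul, ENNReal.toReal_ofReal (abs_nonneg _), Measure.real]

theorem volume_real_openSimplex_pos {n : ℕ}
    (T : Affine.Simplex ℝ (EuclideanSpace ℝ (Fin n)) n) : 0 < volume.real (openSimplex T) :=
  ENNReal.toReal_pos (isOpen_interior.measure_pos volume (nonempty_openSimplex T)).ne'
    ((isCompact_closedSimplex T).isBounded.subset interior_subset).measure_lt_top.ne

/-- The determinant is nonzero because the simplex has positive volume. -/
theorem det_edgeMatrix_ne_zero {n : ℕ} (T : Affine.Simplex ℝ (EuclideanSpace ℝ (Fin n)) n) :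
    (edgeMatrix T).det ≠ 0 := by
  intro h
  have := volume_real_openSimplex_pos T
  rw [volume_real_openSimplex, h, abs_zero, zero_mul] at this
  exact this.false

theorem setIntegral_openSimplex {n : ℕ} (T : Affine.Simplex ℝ (EuclideanSpace ℝ (Fin n)) n)
    (f : EuclideanSpace ℝ (Fin n) → ℝ) :
    ∫ x in openSimplex T, f x =
      |(edgeMatrix T).det| * ∫ x in standardSimplex n, f (refMap T x) := by
  set L : EuclideanSpace ℝ (Fin n) →L[ℝ] EuclideanSpace ℝ (Fin n) :=
    (Matrix.toEuclideanLin (edgeMatrix T)).toContinuousLinearMap with hL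
  have hdet : L.det = (edgeMatrix T).det := det_toEuclideanLin _
  have hinj : Function.Injective (refMap T) := by
    refine (add_right_injective (T.points 0)).comp
      (f := Matrix.toEuclideanLin (edgeMatrix T)) ?_
    rw [← LinearMap.ker_eq_bot]
    by_contra hk
    refine det_edgeMatrix_ne_zero T ?_
    rw [← det_toEuclideanLin]
    exact LinearMap.det_eq_zero_iff_ker_ne_bot.mpr hk
  rw [setIntegral_congr_set (openSimplex_ae_eq_closedSimplex T), ← refMap_image_standardSimplex,
    integral_image_eq_integral_abs_det_fderiv_smul volume (f := refMap T)
      (f' := fun _ => L)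
      (isClosed_standardSimplex n).measurableSet
      (fun x _ => (L.hasFDerivAt.const_add (T.points 0)).hasFDerivWithinAt) hinj.injOn, hdet]
  simp only [smul_eq_mul]
  rw [integral_const_mul]

/-! ### Exactness on arbitrary simplices and the error bound -/

/-- Polynomials of degree at most `m` are stable under the affine reparametrization. -/
theorem exists_eval_eq_eval_refMap {n : ℕ} (T : Affine.Simplex ℝ (EuclideanSpace ℝ (Fin n)) n)
    (p : MvPolynomial (Fin n) ℝ) :
    ∃ q : MvPolynomial (Fin n) ℝ, q.totalDegree ≤ p.totalDegree ∧
      ∀ x : EuclideanSpace ℝ (Fin n), MvPolynomial.eval (fun i => x i) q =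
        MvPolynomial.eval (fun i => refMap T x i) p := by
  let l : Fin n → MvPolynomial (Fin n) ℝ := fun i =>
    MvPolynomial.C (T.points 0 i) + ∑ j, MvPolynomial.C (edgeMatrix T i j) * MvPolynomial.X j
  have hl : ∀ i, (l i).totalDegree ≤ 1 := by
    intro i
    refine (MvPolynomial.totalDegree_add _ _).trans (max_le ?_ ?_)
    · rw [MvPolynomial.totalDegree_C]
      exact zero_le_one
    · refine MvPolynomial.totalDegree_finsetSum_le fun j _ => ?_
      refine (MvPolynomial.totalDegree_mul _ _).trans ?_
      rw [MvPolynomial.totalDegree_C, MvPolynomial.totalDegree_X]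
  refine ⟨∑ d ∈ p.support, MvPolynomial.C (p.coeff d) * ∏ i, l i ^ d i, ?_, fun x => ?_⟩
  · refine MvPolynomial.totalDegree_finsetSum_le fun d hd => ?_
    refine (MvPolynomial.totalDegree_mul _ _).trans ?_
    rw [MvPolynomial.totalDegree_C, zero_add]
    refine (MvPolynomial.totalDegree_finsetProd _ _).trans ?_
    refine le_trans ?_ (MvPolynomial.le_totalDegree hd)
    rw [Finsupp.sum_fintype _ _ fun _ => rfl]
    refine Finset.sum_le_sum fun i _ => (MvPolynomial.totalDegree_pow _ _).trans ?_
    exact (Nat.mul_le_mul_left _ (hl i)).trans (mul_one _).le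
  · have hlx : ∀ i, MvPolynomial.eval (fun i => x i) (l i) = refMap T x i := by
      intro i
      simp [l, refMap_apply_coord]
    rw [MvPolynomial.eval_eq' _ p, map_sum]
    refine Finset.sum_congr rfl fun d _ => ?_
    simp only [map_mul, MvPolynomial.eval_C, map_prod, map_pow, hlx]

/-- Exactness carries over to the transferred rule. -/
theorem QuadratureRule.IsExact.apply_eq {n m : ℕ} {Q : QuadratureRule n} (hQ : Q.IsExact m)
    (T : Affine.Simplex ℝ (EuclideanSpace ℝ (Fin n)) n) {p : MvPolynomial (Fin n) ℝ}
    (hp : p.totalDegree ≤ m) :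
    Q.apply T (fun x => MvPolynomial.eval (fun i => x i) p) =
      ∫ x in openSimplex T, MvPolynomial.eval (fun i => x i) p := by
  obtain ⟨q, hq, hqe⟩ := exists_eval_eq_eval_refMap T p
  have h := hQ q (hq.trans hp)
  simp only [hqe] at h
  rw [setIntegral_openSimplex, ← h, QuadratureRule.apply]

/-- A bound that holds almost everywhere in the interior of a convex body holds at each of its
points, if the function is continuous up to the boundary. -/
theorem _root_.Convex.abs_le_of_ae_interior {E : Type*} [NormedAddCommGroup E] [NormedSpace ℝ E]
    [MeasurableSpace E] [BorelSpace E] {μ : Measure E} [μ.IsOpenPosMeasure] {S : Set E}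
    (hS : Convex ℝ S) (hne : (interior S).Nonempty) {w : E → ℝ} (hw : ContinuousOn w S) {K : ℝ}
    (hK : ∀ᵐ x ∂(μ.restrict (interior S)), |w x| ≤ K) {x : E} (hx : x ∈ S) : |w x| ≤ K := by
  rw [ae_restrict_iff' isOpen_interior.measurableSet] at hK
  have hcl : x ∈ closure (interior S ∩ {x | x ∈ interior S → |w x| ≤ K}) := by
    refine closure_minimal ((Measure.dense_of_ae hK).open_subset_closure_inter isOpen_interior)
      isClosed_closure ?_
    rw [hS.closure_interior_eq_closure_of_nonempty_interior hne]
    exact subset_closure hx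
  exact ContinuousWithinAt.closure_le hcl
    ((hw x hx).abs.mono (Set.inter_subset_left.trans interior_subset))
    continuousWithinAt_const fun y hy => hy.2 hy.1

theorem QuadratureRule.abs_apply_le {n : ℕ} (Q : QuadratureRule n)
    (T : Affine.Simplex ℝ (EuclideanSpace ℝ (Fin n)) n) {w : EuclideanSpace ℝ (Fin n) → ℝ} {K : ℝ}
    (hw : ∀ x ∈ closedSimplex T, |w x| ≤ K) :
    |Q.apply T w| ≤ |(edgeMatrix T).det| * (Q.absWeight * K) := by
  rw [QuadratureRule.apply, abs_mul, abs_abs, QuadratureRule.absWeight, Finset.sum_mul]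
  refine mul_le_mul_of_nonneg_left ((Finset.abs_sum_le_sum_abs _ _).trans
    (Finset.sum_le_sum fun k _ => ?_)) (abs_nonneg _)
  rw [abs_mul]
  refine mul_le_mul_of_nonneg_left (hw _ ?_) (abs_nonneg _)
  rw [← refMap_image_standardSimplex]
  exact Set.mem_image_of_mem _ (Q.node_mem k)

/-- If a polynomial of a degree for which the rule is exact is within `K` of `v`, then the
quadrature error of `v` is that of the difference, hence at most `(W / μ(S_n) + 1) μ(Ω) K`. -/
theorem QuadratureRule.IsExact.abs_apply_sub_integral_le {n m : ℕ} {Q : QuadratureRule n}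
    (hQ : Q.IsExact m) (T : Affine.Simplex ℝ (EuclideanSpace ℝ (Fin n)) n)
    {v : EuclideanSpace ℝ (Fin n) → ℝ} (hv : ContinuousOn v (closedSimplex T))
    {p : MvPolynomial (Fin n) ℝ} (hp : p.totalDegree ≤ m) {K : ℝ}
    (hK : ∀ᵐ x ∂(volume.restrict (openSimplex T)),
      |v x - MvPolynomial.eval (fun i => x i) p| ≤ K) :
    |Q.apply T v - ∫ x in openSimplex T, v x| ≤
      (Q.absWeight / volume.real (standardSimplex n) + 1) * volume.real (openSimplex T) * K := by
  set P : EuclideanSpace ℝ (Fin n) → ℝ := fun x => MvPolynomial.eval (fun i => x i) p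
  have hP : Continuous P := p.continuous_eval.comp (by fun_prop)
  have hpos := volume_real_openSimplex_pos T
  have hint : ∀ {f : EuclideanSpace ℝ (Fin n) → ℝ}, ContinuousOn f (closedSimplex T) →
      IntegrableOn f (openSimplex T) := fun hf =>
    (hf.integrableOn_compact (isCompact_closedSimplex T)).mono_set interior_subset
  have hsub : ContinuousOn (fun x => v x - P x) (closedSimplex T) := hv.sub hP.continuousOn
  have hQv : |Q.apply T fun x => v x - P x| ≤ |(edgeMatrix T).det| * (Q.absWeight * K) :=
    Q.abs_apply_le T fun x hx =>
      (convex_closedSimplex T).abs_le_of_ae_interior (nonempty_openSimplex T) hsub hK hx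
  have hI : |∫ x in openSimplex T, (v x - P x)| ≤ K * volume.real (openSimplex T) := by
    have : IsFiniteMeasure (volume.restrict (openSimplex T)) :=
      isFiniteMeasure_restrict.mpr
        ((isCompact_closedSimplex T).isBounded.subset interior_subset).measure_lt_top.ne
    have h := norm_integral_le_of_norm_le_const (μ := volume.restrict (openSimplex T))
      (f := fun x => v x - P x) (C := K) hK
    rwa [measureReal_restrict_apply_univ] at h
  have hsplit : Q.apply T v - ∫ x in openSimplex T, v x =
      (Q.apply T fun x => v x - P x) - ∫ x in openSimplex T, (v x - P x) := by
    have e1 : (Q.apply T fun x => v x - P x) = Q.apply T v - Q.apply T P := by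
      simp only [QuadratureRule.apply, mul_sub, Finset.sum_sub_distrib]
    rw [e1, hQ.apply_eq T hp, integral_sub (hint hv) (hint hP.continuousOn)]
    ring
  have hS : volume.real (standardSimplex n) ≠ 0 := by
    intro h
    rw [volume_real_openSimplex, h, mul_zero] at hpos
    exact hpos.false
  calc |Q.apply T v - ∫ x in openSimplex T, v x|
      ≤ |(edgeMatrix T).det| * (Q.absWeight * K) + K * volume.real (openSimplex T) := by
        rw [hsplit]
        exact (abs_sub _ _).trans (add_le_add hQv hI)
    _ = (Q.absWeight / volume.real (standardSimplex n) + 1) * volume.real (openSimplex T) * K := by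
        rw [volume_real_openSimplex]
        field_simp

end SimplexQuadrature

open SimplexQuadrature in
theorem mainTheorem3 :
    ∃ C : ℕ → ℕ → ℝ → ℝ,
      (∀ (m n : ℕ) (γ : ℝ), 1 ≤ n → IsBrambleHilbertConstant m n γ (C m n γ)) ∧
      ∀ (m n : ℕ), 1 ≤ n →
        ∀ Q : QuadratureRule n, Q.IsExact m →
        ∀ T : Affine.Simplex ℝ (EuclideanSpace ℝ (Fin n)) n,
        ∀ u : EuclideanSpace ℝ (Fin n) → ℝ, MemSobolev m (openSimplex T) u →
          -- point values of `u` are those of its continuous representative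
          (1 ≤ m → ∃ v : EuclideanSpace ℝ (Fin n) → ℝ,
            ContinuousOn v (closedSimplex T) ∧ v =ᵐ[volume.restrict (openSimplex T)] u) ∧
          ∀ v : EuclideanSpace ℝ (Fin n) → ℝ,
            ContinuousOn v (closedSimplex T) → v =ᵐ[volume.restrict (openSimplex T)] u →
            |Q.apply T v - ∫ x in openSimplex T, u x| ≤
              (Q.absWeight / volume.real (standardSimplex n) + 1) *
                volume.real (openSimplex T) * C m n (chunkiness (openSimplex T)) *
                enclosingDiam (openSimplex T) ^ m * sobolevNorm m (openSimplex T) u := by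
  refine ⟨fun m n _ => (n : ℝ) ^ m, fun m n γ _ => isBrambleHilbertConstant m n γ,
    fun m n _ Q hQ T u hu => ?_⟩
  have hb : Bornology.IsBounded (openSimplex T) :=
    (isCompact_closedSimplex T).isBounded.subset interior_subset
  have hconv : Convex ℝ (openSimplex T) := (convex_closedSimplex T).interior
  refine ⟨fun hm => ?_, fun v hv hvu => ?_⟩
  · obtain ⟨v, ⟨K, hK⟩, hvu⟩ := hu.exists_lipschitz_ae_eq hm isOpen_interior hb hconv
    exact ⟨v, hK.continuous.continuousOn, hvu⟩
  · obtain ⟨p, hp, hpu⟩ := isBrambleHilbertConstant m n (chunkiness (openSimplex T))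
      (openSimplex T) (nonempty_openSimplex T) hb isOpen_interior hconv rfl u hu
    rw [← integral_congr_ae hvu]
    refine (hQ.abs_apply_sub_integral_le T hv hp (K := (n : ℝ) ^ m *
      enclosingDiam (openSimplex T) ^ m * sobolevNorm m (openSimplex T) u) ?_).trans (le_of_eq ?_)
    · filter_upwards [hpu, hvu] with x hx hxv
      rwa [hxv]
    · ring
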